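/- Let $p>2$ be a prime. For profinite groups $U$ and $G$ let $T^U(G)$ be the intersection of the kernels of all continuous homomorphisms $G\to U$. Let $G^{(n,p)}$, $n\ge 1$, be the lower $p$-central filtration of $G$ in the profinite sense: $G^{(1,p)}=G$, and $G^{(n+1,p)}=(G^{(n,p)})^p[G,G^{(n,p)}]$ is the closed subgroup generated by all $p$-th powers of elements of $G^{(n,p)}$ and all commutators $[g,x]$ with $g\in G$, $x\in G^{(n,p)}$. Let $M_{p^3}=\langle r,s\mid r^{p^2}=s^p=1,\ [r,s]=r^p\rangle$ be the extra-special group of order $p^3$ and exponent $p^2$. Write $H^i(G)=H^i(G,\mathbb{Z}/p)$ for profinite cohomology with trivial action on $\mathbb{Z}/p$, so $H^1(G)=\mathrm{Hom}_{\mathrm{cont}}(G,\mathbb{Z}/p)$; let $\cup\colon H^1(G)\times H^1(G)\to H^2(G)$ be the cup product and let $\mathrm{Bock}\colon H^1(G)\to H^2(G)$ be the Bockstein homomorphism, i.e. the connecting homomorphism of $0\to\mathbb{Z}/p\to\mathbb{Z}/p^2\to\mathbb{Z}/p\to0$. With $\bar G=G/G^{(2,p)}$, say that $G$ satisfies the Bockstein–cup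 kernel condition if the group $\mathrm{Ker}\bigl(\inf\colon H^2(\bar G)\to H^2(G)\bigr)$ is generated by those of its elements that have the form $\mathrm{Bock}(\bar\rho)$ or $\mathrm{Bock}(\bar\rho)+\bar\rho\cup\bar\rho'$ with $\bar\rho,\bar\rho'\in H^1(\bar G)$. **Theorem.** Let $S$ be a free profinite group, let $N$ be a closed normal subgroup of $S$ contained in $S^{(2,p)}$, and let $G=S/N$. Then $$T^{\mathbb{Z}/p^2}(G)\cap T^{M_{p^3}}(G)=G^{(3,p)}$$ if and only if $G$ satisfies the Bockstein–cup kernel condition. -/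

import Mathlib

universe u

section ProfiniteGroups

/-- `ι : X → S` exhibits the topological group `S` as the free profinite group on the basis `X`
(converging to `1`): the family `ι` converges to `1`, i.e. every neighbourhood of `1` contains
all but finitely many of the `ι x`, and every family `φ : X → H` converging to `1` in a profinite
group `H` extends uniquely to a continuous homomorphism `S → H`.
If `X` is finite, then the convergence conditions are void. -/
structure IsFreeProfiniteOn {S X : Type u} [Group S] [TopologicalSpace S] (ι : X → S) : Prop where
  tendsto_one : Filter.Tendsto ι Filter.cofinite (nhds 1)
  existsUnique_lift : ∀ (H : Type u) [Group H] [TopologicalSpace H] [IsTopologicalGroup H]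
    [CompactSpace H] [TotallyDisconnectedSpace H] (φ : X → H),
    Filter.Tendsto φ Filter.cofinite (nhds 1) → ∃! f : S →ₜ* H, ∀ x, f (ι x) = φ x

/-- A profinite group is free if it is free on some basis converging to `1`. -/
def IsFreeProfinite (S : Type u) [Group S] [TopologicalSpace S] [IsTopologicalGroup S]
    [CompactSpace S] [TotallyDisconnectedSpace S] : Prop :=
  ∃ (X : Type u) (ι : X → S), IsFreeProfiniteOn ι

variable (G : Type*) [Group G] [TopologicalSpace G]

/-- `T^U(G)`: the intersection of the kernels of all continuous homomorphisms `G → U`. -/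
def kernelIntersection (U : Type*) [Group U] [TopologicalSpace U] : Subgroup G :=
  ⨅ ρ : G →ₜ* U, (ρ : G →* U).ker

variable [IsTopologicalGroup G]

/-- The lower `p`-central filtration in the profinite sense: `G^(1,p) = G`, and `G^(n+1,p)` is the
closed subgroup generated by the `p`-th powers of elements of `G^(n,p)` and by the commutators
`[g, x]` with `g ∈ G` and `x ∈ G^(n,p)`. (The filtration starts at `n = 1`; the value at `n = 0`
is set to be `G`.) -/
def lowerPCentral (p : ℕ) : ℕ → Subgroup G
  | 0 => ⊤
  | 1 => ⊤
  | n + 2 => (Subgroup.closure ((fun x : G => x ^ p) '' (lowerPCentral p (n + 1) : Set G)) ⊔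
      ⁅(⊤ : Subgroup G), lowerPCentral p (n + 1)⁆).topologicalClosure

theorem normal_closure_pow_image {G : Type*} [Group G] (p : ℕ) (K : Subgroup G) [hK : K.Normal] :
    (Subgroup.closure ((fun x : G => x ^ p) '' (K : Set G))).Normal := by
  refine ⟨fun x hx g => ?_⟩
  induction hx using Subgroup.closure_induction with
  | mem y hy =>
    obtain ⟨z, hz, rfl⟩ := hy
    refine Subgroup.subset_closure ⟨g * z * g⁻¹, hK.conj_mem z hz g, ?_⟩
    simp [conj_pow]
  | one => simp
  | mul a b _ _ ha hb =>
    have : g * (a * b) * g⁻¹ = (g * a * g⁻¹) * (g * b * g⁻¹) := by group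
    rw [this]
    exact mul_mem ha hb
  | inv a _ ha =>
    have : g * a⁻¹ * g⁻¹ = (g * a * g⁻¹)⁻¹ := by group
    rw [this]
    exact inv_mem ha

instance lowerPCentral_normal (p n : ℕ) : (lowerPCentral G p n).Normal := by
  induction n with
  | zero => exact (inferInstance : (⊤ : Subgroup G).Normal)
  | succ n ih =>
    cases n with
    | zero => exact (inferInstance : (⊤ : Subgroup G).Normal)
    | succ n =>
      have := ih
      have := normal_closure_pow_image p (lowerPCentral G p (n + 1))
      exact Subgroup.is_normal_topologicalClosure
        (Subgroup.closure ((fun x : G => x ^ p) '' (lowerPCentral G p (n + 1) : Set G)) ⊔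
          ⁅(⊤ : Subgroup G), lowerPCentral G p (n + 1)⁆)

end ProfiniteGroups

section ExtraSpecialGroup

/-- The defining relators of `⟨r, s | r^(p²) = s^p = 1, [r, s] = r^p⟩`, where `r` and `s` are the
free generators of index `0` and `1`. -/
def extraSpecialRels (p : ℕ) : Set (FreeGroup (Fin 2)) :=
  {FreeGroup.of 0 ^ p ^ 2, FreeGroup.of 1 ^ p,
    (FreeGroup.of 0 * FreeGroup.of 1 * (FreeGroup.of 0)⁻¹ * (FreeGroup.of 1)⁻¹) *
      (FreeGroup.of 0 ^ p)⁻¹}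

/-- The group `M_{p³} = ⟨r, s | r^(p²) = s^p = 1, [r, s] = r^p⟩`; for an odd prime `p` this is the
extra-special group of order `p³` and exponent `p²`. -/
abbrev ExtraSpecialGroup (p : ℕ) : Type := PresentedGroup (extraSpecialRels p)

/-- The finite group `M_{p³}` carries the discrete topology. -/
instance ExtraSpecialGroup.instTopologicalSpace (p : ℕ) :
    TopologicalSpace (ExtraSpecialGroup p) := ⊥

instance ExtraSpecialGroup.instDiscreteTopology (p : ℕ) :
    DiscreteTopology (ExtraSpecialGroup p) := ⟨rfl⟩

end ExtraSpecialGroup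

namespace TrivialCoeffCohomology

/-! Continuous cohomology in degrees `1` and `2` of a topological group with coefficients in the
discrete module `ℤ/p` with trivial action, through continuous inhomogeneous cochains. -/

variable (p : ℕ) (G : Type*) [Group G] [TopologicalSpace G]

/-- `H¹(G) = Hom_cont(G, ℤ/p)`. -/
abbrev H1 : Type _ := G →ₜ* Multiplicative (ZMod p)

variable {p G} in
/-- The value of `χ ∈ H¹(G)` at `g`, as an element of `ℤ/p`. -/
def H1.val (χ : H1 p G) (g : G) : ZMod p := (χ g).toAdd

variable {p G} in
theorem H1.val_mul (χ : H1 p G) (g h : G) : χ.val (g * h) = χ.val g + χ.val h := by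
  simp [H1.val]

variable {p G} in
theorem H1.continuous_val (χ : H1 p G) : Continuous χ.val :=
  continuous_toAdd.comp χ.continuous_toFun

variable [IsTopologicalGroup G]

/-- The differential `(d c)(g, h) = c h - c (g h) + c g` from continuous `1`-cochains to continuous
`2`-cochains. -/
def d1 : C(G, ZMod p) →+ C(G × G, ZMod p) where
  toFun c := ⟨fun x => c x.2 - c (x.1 * x.2) + c x.1, by fun_prop⟩
  map_zero' := by ext; simp
  map_add' a b := by
    ext
    simp only [ContinuousMap.add_apply, ContinuousMap.coe_mk]
    ring

/-- Continuous `2`-cocycles. -/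
def Z2 : AddSubgroup C(G × G, ZMod p) where
  carrier := {f | ∀ g h k : G, f (h, k) - f (g * h, k) + f (g, h * k) - f (g, h) = 0}
  zero_mem' := by simp
  add_mem' := by
    intro a b ha hb g h k
    simp only [ContinuousMap.add_apply]
    linear_combination ha g h k + hb g h k
  neg_mem' := by
    intro a ha g h k
    simp only [ContinuousMap.neg_apply]
    linear_combination -ha g h k

/-- Continuous `2`-coboundaries. -/
def B2 : AddSubgroup C(G × G, ZMod p) := (d1 p G).range

theorem B2_le_Z2 : B2 p G ≤ Z2 p G := by
  rintro _ ⟨c, rfl⟩ g h k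
  simp only [d1, AddMonoidHom.coe_mk, ZeroHom.coe_mk, ContinuousMap.coe_mk, mul_assoc]
  ring

/-- `H²(G) = H²(G, ℤ/p)`: continuous `2`-cocycles modulo continuous `2`-coboundaries. -/
abbrev H2 : Type _ := Z2 p G ⧸ (B2 p G).addSubgroupOf (Z2 p G)

variable {p G}

/-- The class in `H²(G)` of a continuous `2`-cocycle. -/
def H2.mk (f : Z2 p G) : H2 p G := QuotientAddGroup.mk f

section Functoriality

variable {G' : Type*} [Group G'] [TopologicalSpace G'] [IsTopologicalGroup G']

/-- Pullback of continuous `2`-cocycles along a continuous homomorphism. -/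
def Z2.pullback (φ : G →ₜ* G') : Z2 p G' →+ Z2 p G where
  toFun f := ⟨⟨fun x => f.1 (φ x.1, φ x.2),
      f.1.continuous.comp (by
        have := φ.continuous_toFun
        exact ((this.comp continuous_fst).prodMk (this.comp continuous_snd)))⟩, by
    intro g h k
    simpa using f.2 (φ g) (φ h) (φ k)⟩
  map_zero' := rfl
  map_add' _ _ := rfl

/-- The map `H²(G') → H²(G)` induced by a continuous homomorphism `G → G'`. -/
def H2.map (φ : G →ₜ* G') : H2 p G' →+ H2 p G :=
  QuotientAddGroup.map _ _ (Z2.pullback φ) (by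
    rintro ⟨f, hf⟩ ⟨c, hc⟩
    refine ⟨⟨fun g => c (φ g), c.continuous.comp φ.continuous_toFun⟩, ?_⟩
    ext ⟨g, h⟩
    have h1 : c (φ h) - c (φ g * φ h) + c (φ g) = f (φ g, φ h) :=
      congrArg (fun F : C(G' × G', ZMod p) => F (φ g, φ h)) hc
    rw [← map_mul] at h1
    exact h1)

end Functoriality

/-- The inflation map `H²(G/K) → H²(G)`. -/
def inflation (K : Subgroup G) [K.Normal] : H2 p (G ⧸ K) →+ H2 p G :=
  H2.map ⟨QuotientGroup.mk' K, QuotientGroup.continuous_mk⟩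

/-- The cup product `χ ∪ ψ ∈ H²(G)` of `χ, ψ ∈ H¹(G)`, the class of `(g, h) ↦ χ(g) ψ(h)`. -/
def cup (χ ψ : H1 p G) : H2 p G :=
  H2.mk ⟨⟨fun x => χ.val x.1 * ψ.val x.2,
      (χ.continuous_val.comp continuous_fst).mul (ψ.continuous_val.comp continuous_snd)⟩, by
    intro g h k
    simp only [ContinuousMap.coe_mk, H1.val_mul]
    ring⟩

/-- The `p`-adic carry of `a, b ∈ ℤ/p`: the quotient by `p` of the sum of the representatives of
`a` and `b` in `{0, …, p-1}`. -/
def carry (a b : ZMod p) : ℕ := (a.val + b.val) / p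

theorem val_add_val_eq [NeZero p] (a b : ZMod p) :
    a.val + b.val = (a + b).val + p * carry a b := by
  rw [ZMod.val_add, carry, Nat.mod_add_div]

theorem carry_cocycle [NeZero p] (a b c : ZMod p) :
    carry b c + carry a (b + c) = carry (a + b) c + carry a b := by
  have h1 := val_add_val_eq b c
  have h2 := val_add_val_eq a (b + c)
  have h3 := val_add_val_eq (a + b) c
  have h4 := val_add_val_eq a b
  rw [← add_assoc] at h2
  apply Nat.eq_of_mul_eq_mul_left (Nat.pos_of_ne_zero (NeZero.ne p))
  rw [mul_add, mul_add]
  omega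

/-- The carry is what the connecting homomorphism of `0 → ℤ/p → ℤ/p² → ℤ/p → 0` computes: if
`s : ℤ/p → ℤ/p²` is the section through representatives in `{0, …, p-1}`, and the embedding
`ℤ/p → ℤ/p²` sends the class of `n` to the class of `p n`, then `s(a) + s(b) - s(a+b)` is the image
of the carry of `a` and `b`. -/
theorem carry_spec [NeZero p] (a b : ZMod p) :
    (b.val : ZMod (p ^ 2)) - ((a + b).val : ZMod (p ^ 2)) + (a.val : ZMod (p ^ 2)) =
      (p : ZMod (p ^ 2)) * (carry a b : ZMod (p ^ 2)) := by
  have h := congrArg (Nat.cast : ℕ → ZMod (p ^ 2)) (val_add_val_eq a b)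
  push_cast at h
  linear_combination h

/-- The Bockstein homomorphism `H¹(G) → H²(G)`, i.e. the connecting homomorphism of the short exact
sequence `0 → ℤ/p → ℤ/p² → ℤ/p → 0` of trivial modules: lift `χ` to the continuous cochain
`s ∘ χ : G → ℤ/p²`, where `s` takes representatives in `{0, …, p-1}`; its coboundary takes values
in the image of `ℤ/p`, namely it is the carry of `χ(g)` and `χ(h)`. -/
def bockstein [NeZero p] (χ : H1 p G) : H2 p G :=
  H2.mk ⟨⟨fun x => (carry (χ.val x.1) (χ.val x.2) : ZMod p),
      (continuous_of_discreteTopology (f := fun y : ZMod p × ZMod p =>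
        (carry y.1 y.2 : ZMod p))).comp
        ((χ.continuous_val.comp continuous_fst).prodMk
          (χ.continuous_val.comp continuous_snd))⟩, by
    intro g h k
    have := congrArg (Nat.cast : ℕ → ZMod p) (carry_cocycle (χ.val g) (χ.val h) (χ.val k))
    push_cast at this
    simp only [ContinuousMap.coe_mk, H1.val_mul]
    linear_combination this⟩

end TrivialCoeffCohomology

open TrivialCoeffCohomology in
/-- The Bockstein-cup kernel condition: with `Ḡ = G / G^(2,p)`, the kernel of the inflation map
`H²(Ḡ) → H²(G)` is generated (as a group) by those of its elements that have the form `Bock(ρ)`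
or `Bock(ρ) + ρ ∪ ρ'` with `ρ, ρ' ∈ H¹(Ḡ)`. -/
def BocksteinCupKernelCondition (p : ℕ) [NeZero p] (G : Type*) [Group G] [TopologicalSpace G]
    [IsTopologicalGroup G] : Prop :=
  (inflation (p := p) (lowerPCentral G p 2)).ker =
    AddSubgroup.closure {α : H2 p (G ⧸ lowerPCentral G p 2) |
      α ∈ (inflation (p := p) (lowerPCentral G p 2)).ker ∧
        ((∃ ρ : H1 p (G ⧸ lowerPCentral G p 2), α = bockstein ρ) ∨
          ∃ ρ ρ' : H1 p (G ⧸ lowerPCentral G p 2), α = bockstein ρ + cup ρ ρ')}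

/-! `M_{p³}` is the central extension of `(ℤ/p)²` by `ℤ/p` with class `Bock(x) + x ∪ y`
(`extraSpecialGroupEquiv`), and it contains `ℤ/p²`, so the intersection on the left is just
`T^M(G)`, where `M = M_{p³}`. A homomorphism `G → M` is a pair of characters `ρ, ρ'` with a cochain
on `G` whose coboundary is, up to sign, the inflation of the cocycle of `Bock(ρ) + ρ ∪ ρ'`.

A class in the kernel of inflation from `Ḡ = G / G^(2,p)` becomes a coboundary `dc` on `G`, and `c -
c(1)` restricts to a character of `G^(2,p)` that kills `G^(3,p)`. This is the transgression read
backwards. The character determines the class, and the class determines the character because `H¹(Ḡ)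
→ H¹(G)` is onto. Thus the kernel of inflation is dual to `G^(2,p) / G^(3,p)`, and `T^M(G)` is the
annihilator in `G^(2,p)` of the classes `Bock(ρ) + ρ ∪ ρ'` in that kernel.

The theorem is then duality: the annihilator is `G^(3,p)` exactly when these classes generate the
kernel. One direction uses compactness and linear algebra
(`ker_inflation_eq_closure_of_kernelIntersection_le`), the other the existence of enough characters
(`kernelIntersection_eq_of_ker_inflation_eq_closure`). -/

open TrivialCoeffCohomology

/-! ### Powers of elements with central commutator -/

section HeisenbergCommutation

/-- A central commutator `z = [x, y]` is bilinear in the exponents. -/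
theorem mul_pow_eq_of_commutator_central {Γ : Type*} [Group Γ] {x y z : Γ}
    (h : x * y = z * (y * x)) (hx : Commute z x) (hy : Commute z y) (n m : ℕ) :
    x ^ n * y ^ m = z ^ (n * m) * (y ^ m * x ^ n) := by
  have h1 : ∀ m : ℕ, x * y ^ m = z ^ m * (y ^ m * x) := by
    intro m
    induction m with
    | zero => simp
    | succ m ih =>
      have hc : y ^ m * z = z * y ^ m := ((hy.pow_right m).eq).symm
      calc x * y ^ (m + 1) = z ^ m * (y ^ m * (x * y)) := by
            rw [pow_succ, ← mul_assoc, ih]; simp only [mul_assoc]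
        _ = z ^ m * (y ^ m * z * (y * x)) := by rw [h]; simp only [mul_assoc]
        _ = z ^ (m + 1) * (y ^ (m + 1) * x) := by
            rw [hc, pow_succ z, pow_succ y]; simp only [mul_assoc]
  induction n with
  | zero => simp
  | succ n ih =>
    have hc : x ^ n * z ^ m = z ^ m * x ^ n := (((hx.pow_right n).pow_left m).eq).symm
    calc x ^ (n + 1) * y ^ m = x ^ n * (x * y ^ m) := by rw [pow_succ, mul_assoc]
      _ = x ^ n * z ^ m * (y ^ m * x) := by rw [h1, mul_assoc]
      _ = z ^ m * (x ^ n * y ^ m * x) := by rw [hc]; simp only [mul_assoc]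
      _ = z ^ (m + n * m) * (y ^ m * x ^ (n + 1)) := by
          rw [ih, pow_add, pow_succ x]; simp only [mul_assoc]
      _ = z ^ ((n + 1) * m) * (y ^ m * x ^ (n + 1)) := by
          rw [Nat.succ_mul, add_comm]

theorem pow_eq_pow_of_natCast_eq {Γ : Type*} [Group Γ] {p : ℕ} {g : Γ} (hg : g ^ p = 1) {m n : ℕ}
    (h : (m : ZMod p) = n) : g ^ m = g ^ n :=
  pow_eq_pow_iff_modEq.mpr
    (((ZMod.natCast_eq_natCast_iff _ _ _).mp h).of_dvd (orderOf_dvd_of_pow_eq_one hg))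

end HeisenbergCommutation


/-! ### A cocycle model of `M_{p³}` -/

theorem TrivialCoeffCohomology.carry_zero_left (p : ℕ) [NeZero p] (a : ZMod p) : carry 0 a = 0 := by
  simp [carry, ZMod.val_lt]

theorem TrivialCoeffCohomology.carry_zero_right (p : ℕ) [NeZero p] (a : ZMod p) :
    carry a 0 = 0 := by
  simp [carry, ZMod.val_lt]

/-- The central extension of `(ℤ/p)²` by `ℤ/p` with cocycle
`((a, b), (a', b')) ↦ carry a a' + a b'`. -/
@[ext] structure BocksteinCupExtension (p : ℕ) where
  fst : ZMod p
  snd : ZMod p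
  central : ZMod p

namespace BocksteinCupExtension

variable {p : ℕ}

instance : Mul (BocksteinCupExtension p) where
  mul x y := ⟨x.fst + y.fst, x.snd + y.snd,
    x.central + y.central + carry x.fst y.fst + x.fst * y.snd⟩

instance : One (BocksteinCupExtension p) := ⟨⟨0, 0, 0⟩⟩

instance : Inv (BocksteinCupExtension p) where
  -- The central coordinate is the one forced by `x⁻¹ * x = 1`.
  inv x := ⟨-x.fst, -x.snd, -x.central - carry (-x.fst) x.fst + x.fst * x.snd⟩

@[simp] theorem one_fst : (1 : BocksteinCupExtension p).fst = 0 := rfl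
@[simp] theorem one_snd : (1 : BocksteinCupExtension p).snd = 0 := rfl
@[simp] theorem one_central : (1 : BocksteinCupExtension p).central = 0 := rfl
@[simp] theorem mul_fst (x y : BocksteinCupExtension p) : (x * y).fst = x.fst + y.fst := rfl
@[simp] theorem mul_snd (x y : BocksteinCupExtension p) : (x * y).snd = x.snd + y.snd := rfl
@[simp] theorem mul_central (x y : BocksteinCupExtension p) :
    (x * y).central = x.central + y.central + carry x.fst y.fst + x.fst * y.snd := rfl
@[simp] theorem inv_fst (x : BocksteinCupExtension p) : x⁻¹.fst = -x.fst := rfl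
@[simp] theorem inv_snd (x : BocksteinCupExtension p) : x⁻¹.snd = -x.snd := rfl
@[simp] theorem inv_central (x : BocksteinCupExtension p) :
    x⁻¹.central = -x.central - carry (-x.fst) x.fst + x.fst * x.snd := rfl

instance [NeZero p] : Group (BocksteinCupExtension p) :=
  Group.ofLeftAxioms
    (by
      intro x y z
      ext
      · simp [add_assoc]
      · simp [add_assoc]
      · have := congrArg (Nat.cast : ℕ → ZMod p) (carry_cocycle x.fst y.fst z.fst)
        push_cast at this
        simp only [mul_central, mul_fst, mul_snd]
        linear_combination -this)
    (by intro x; ext <;> simp [carry_zero_left])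
    (by intro x; ext <;> simp; ring)

/-- The generator `r` of `M_{p³}`. -/
abbrev r (p : ℕ) : ExtraSpecialGroup p := PresentedGroup.of 0

/-- The generator `s` of `M_{p³}`. -/
abbrev s (p : ℕ) : ExtraSpecialGroup p := PresentedGroup.of 1

theorem r_pow_sq : r p ^ p ^ 2 = 1 :=
  (PresentedGroup.one_of_mem (rels := extraSpecialRels p) (x := FreeGroup.of 0 ^ p ^ 2)
    (by simp [extraSpecialRels]))

theorem s_pow : s p ^ p = 1 :=
  (PresentedGroup.one_of_mem (rels := extraSpecialRels p) (x := FreeGroup.of 1 ^ p)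
    (by simp [extraSpecialRels]))

theorem r_mul_s : r p * s p = r p ^ p * (s p * r p) := by
  have h : r p * s p * (r p)⁻¹ * (s p)⁻¹ * (r p ^ p)⁻¹ = 1 :=
    PresentedGroup.one_of_mem (rels := extraSpecialRels p)
      (x := (FreeGroup.of 0 * FreeGroup.of 1 * (FreeGroup.of 0)⁻¹ * (FreeGroup.of 1)⁻¹) *
      (FreeGroup.of 0 ^ p)⁻¹) (by simp [extraSpecialRels])
  rwa [mul_inv_eq_one, mul_inv_eq_iff_eq_mul, mul_inv_eq_iff_eq_mul, mul_assoc] at h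

/-- Conjugation by `s` sends `r` to `r^(1-p)`, hence `r^p` to `r^(p-p²) = r^p`. -/
theorem commute_r_pow_s : Commute (r p ^ p) (s p) := by
  have h : s p * r p * (s p)⁻¹ = (r p ^ p)⁻¹ * r p := by
    rw [eq_inv_mul_iff_mul_eq, ← mul_assoc, ← r_mul_s, mul_inv_cancel_right]
  have h2 : s p * r p ^ p * (s p)⁻¹ = r p ^ p := by
    rw [← conj_pow, h, ((Commute.refl (r p)).pow_left p).inv_left.mul_pow, inv_pow, ← pow_mul,
      ← pow_two, r_pow_sq, inv_one, one_mul]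
  exact (mul_inv_eq_iff_eq_mul.mp h2).symm

/-- Moving `r^a` past `s^b'` costs `(r^p)^(a b')`, the cup product term of the cocycle. Exponents
stay in `ℕ`, so no carry appears yet. -/
theorem normalForm_mul (a b c a' b' c' : ℕ) :
    (s p ^ b * r p ^ a * (r p ^ p) ^ c) * (s p ^ b' * r p ^ a' * (r p ^ p) ^ c') =
      s p ^ (b + b') * r p ^ (a + a') * (r p ^ p) ^ (c + c' + a * b') := by
  have hzr : Commute (r p ^ p) (r p) := (Commute.refl (r p)).pow_left p
  have hzs : Commute (r p ^ p) (s p) := commute_r_pow_s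
  have h := mul_pow_eq_of_commutator_central r_mul_s hzr hzs a b'
  generalize r p ^ p = z at *
  have e1 : z ^ c * s p ^ b' = s p ^ b' * z ^ c := ((hzs.pow_left _).pow_right _).eq
  have e2 : z ^ c * r p ^ a' = r p ^ a' * z ^ c := ((hzr.pow_left _).pow_right _).eq
  have e3 : z ^ (a * b') * s p ^ b' = s p ^ b' * z ^ (a * b') :=
    ((hzs.pow_left _).pow_right _).eq
  have e4 : z ^ (a * b') * (r p ^ a * r p ^ a') = (r p ^ a * r p ^ a') * z ^ (a * b') := by
    rw [← pow_add]; exact ((hzr.pow_left _).pow_right _).eq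
  calc _ = s p ^ b * (r p ^ a * (z ^ c * s p ^ b') * r p ^ a' * z ^ c') := by
        simp only [mul_assoc]
    _ = s p ^ b * ((r p ^ a * s p ^ b') * (z ^ c * r p ^ a') * z ^ c') := by
        rw [e1]; simp only [mul_assoc]
    _ = s p ^ b * ((z ^ (a * b') * s p ^ b') * (r p ^ a * r p ^ a') * (z ^ c * z ^ c')) := by
        rw [e2, h]; simp only [mul_assoc]
    _ = s p ^ b * s p ^ b' * (z ^ (a * b') * (r p ^ a * r p ^ a')) * (z ^ c * z ^ c') := by
        rw [e3]; simp only [mul_assoc]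
    _ = s p ^ b * s p ^ b' * (r p ^ a * r p ^ a') * (z ^ c * z ^ c' * z ^ (a * b')) := by
        rw [e4, ← pow_add z, ← pow_add z, add_comm (c + c'), pow_add z (a * b')]; simp only [mul_assoc]
    _ = _ := by simp only [pow_add, mul_assoc]

variable [Fact p.Prime]

/-- The first generator, of order `p²`. -/
def gen₀ : BocksteinCupExtension p := ⟨1, 0, 0⟩

/-- The second generator, of order `p`. -/
def gen₁ : BocksteinCupExtension p := ⟨0, 1, 0⟩

/-- The central coordinate gains `1` each time the first one wraps around modulo `p`. -/
theorem gen₀_pow (n : ℕ) :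
    (gen₀ : BocksteinCupExtension p) ^ n = ⟨n, 0, (n / p : ℕ)⟩ := by
  have hp : 0 < p := (Fact.out : p.Prime).pos
  induction n with
  | zero => ext <;> simp
  | succ n ih =>
    rw [pow_succ, ih]
    ext
    · simp [gen₀]
    · simp [gen₀]
    · have : (n + 1) / p = n / p + carry (n : ZMod p) (1 : ZMod p) := by
        rw [carry, ZMod.val_natCast, ZMod.val_one]
        conv_lhs => rw [← Nat.div_add_mod n p, add_assoc, Nat.mul_add_div hp]
      simp [gen₀, this]

theorem gen₁_pow (n : ℕ) : (gen₁ : BocksteinCupExtension p) ^ n = ⟨0, n, 0⟩ := by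
  induction n with
  | zero => ext <;> simp
  | succ n ih =>
    rw [pow_succ, ih]
    ext <;> simp [gen₁, carry_zero_left]

theorem gen₀_pow_self : (gen₀ : BocksteinCupExtension p) ^ p = ⟨0, 0, 1⟩ := by
  rw [gen₀_pow, Nat.div_self (Fact.out : p.Prime).pos]
  simp

/-- The homomorphism from `M_{p³}` to the concrete extension. -/
def ofExtraSpecialGroup : ExtraSpecialGroup p →* BocksteinCupExtension p :=
  PresentedGroup.toGroup (f := ![gen₀, gen₁]) (by
    have hp : 0 < p := (Fact.out : p.Prime).pos
    rintro w (rfl | rfl | rfl)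
    · rw [map_pow]
      simp only [FreeGroup.lift_apply_of, Matrix.cons_val_zero]
      rw [gen₀_pow, pow_two, Nat.mul_div_cancel _ hp]
      ext <;> simp
    · rw [map_pow]
      simp only [FreeGroup.lift_apply_of, Matrix.cons_val_one, Matrix.cons_val_zero]
      rw [gen₁_pow]
      ext <;> simp
    · simp only [map_mul, map_inv, map_pow, FreeGroup.lift_apply_of, Matrix.cons_val_zero,
        Matrix.cons_val_one]
      rw [mul_inv_eq_one, mul_inv_eq_iff_eq_mul, mul_inv_eq_iff_eq_mul, gen₀_pow_self]
      ext <;> simp [gen₀, gen₁, carry_zero_left, carry_zero_right, mul_assoc])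

theorem ofExtraSpecialGroup_of (i : Fin 2) :
    ofExtraSpecialGroup (p := p) (PresentedGroup.of i) = ![gen₀, gen₁] i :=
  PresentedGroup.toGroup.of _

/-- The homomorphism from the concrete extension to `M_{p³}`. -/
def toExtraSpecialGroup : BocksteinCupExtension p →* ExtraSpecialGroup p :=
  MonoidHom.mk' (fun x => s p ^ x.snd.val * r p ^ x.fst.val * (r p ^ p) ^ x.central.val) (by
    intro x y
    have hz : (r p ^ p) ^ p = 1 := by rw [← pow_mul, ← pow_two, r_pow_sq]
    -- Reducing the exponent of `r` modulo `p` releases a power of `r^p` equal to the carry: this is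
    -- the Bockstein term.
    rw [normalForm_mul, val_add_val_eq x.fst y.fst, pow_add (r p), pow_mul, mul_fst, mul_snd,
      mul_central, pow_eq_pow_of_natCast_eq (m := x.snd.val + y.snd.val) (n := (x.snd + y.snd).val)
        s_pow (by simp)]
    simp only [mul_assoc]
    rw [← pow_add (r p ^ p)]
    congr 2
    apply pow_eq_pow_of_natCast_eq hz
    simp
    ring)

theorem toExtraSpecialGroup_ofExtraSpecialGroup (x : ExtraSpecialGroup p) :
    toExtraSpecialGroup (ofExtraSpecialGroup x) = x := by
  have : (toExtraSpecialGroup (p := p)).comp ofExtraSpecialGroup = MonoidHom.id _ := by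
    refine PresentedGroup.ext fun i => ?_
    rw [MonoidHom.comp_apply, ofExtraSpecialGroup_of]
    fin_cases i <;> simp [toExtraSpecialGroup, gen₀, gen₁, ZMod.val_one]
  exact DFunLike.congr_fun this x

theorem ofExtraSpecialGroup_toExtraSpecialGroup (x : BocksteinCupExtension p) :
    ofExtraSpecialGroup (toExtraSpecialGroup x) = x := by
  have hz (n : ℕ) : (⟨0, 0, 1⟩ : BocksteinCupExtension p) ^ n = ⟨0, 0, n⟩ := by
    induction n with
    | zero => ext <;> simp
    | succ n ih => rw [pow_succ, ih]; ext <;> simp [carry_zero_left]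
  have hx : x.fst.val / p = 0 := Nat.div_eq_of_lt (ZMod.val_lt _)
  simp only [toExtraSpecialGroup, MonoidHom.mk'_apply, map_mul, map_pow, ofExtraSpecialGroup_of,
    Matrix.cons_val_zero, Matrix.cons_val_one]
  rw [gen₀_pow_self, gen₀_pow, gen₁_pow, hz]
  ext <;> simp [carry_zero_left, carry_zero_right, hx]

variable (p) in
/-- The group `M_{p³}` is the central extension of `(ℤ/p)²` by `ℤ/p` with class `Bock + ∪`. -/
def extraSpecialGroupEquiv : ExtraSpecialGroup p ≃* BocksteinCupExtension p where
  toFun := ofExtraSpecialGroup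
  invFun := toExtraSpecialGroup
  left_inv := toExtraSpecialGroup_ofExtraSpecialGroup
  right_inv := ofExtraSpecialGroup_toExtraSpecialGroup
  map_mul' := map_mul _

end BocksteinCupExtension

/-! ### Separating points by open normal subgroups and equivariant functions -/

section Separation

/-- For a small open normal `U`, the coset `U⁻¹x` misses `L`, so `UL` misses `x`. -/
theorem exists_openNormal_of_notMem_closed {S : Type*} [Group S] [TopologicalSpace S]
    [IsTopologicalGroup S] [CompactSpace S] [TotallyDisconnectedSpace S] {L : Subgroup S}
    [hL : L.Normal] (hLc : IsClosed (L : Set S)) {x : S} (hx : x ∉ L) :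
    ∃ V : Subgroup S, V.Normal ∧ IsOpen (V : Set S) ∧ L ≤ V ∧ x ∉ V := by
  have hU : IsOpen {u : S | u⁻¹ * x ∉ L} :=
    hLc.isOpen_compl.preimage (by fun_prop : Continuous fun u : S => u⁻¹ * x)
  obtain ⟨U, hU⟩ := ProfiniteGrp.exist_openNormalSubgroup_sub_open_nhds_of_one hU (by simpa using hx)
  refine ⟨U.toSubgroup ⊔ L, Subgroup.sup_normal _ _,
    Subgroup.isOpen_mono le_sup_left U.isOpen, le_sup_right, fun h => ?_⟩
  obtain ⟨u, hu, l, hl, rfl⟩ := Subgroup.mem_sup_of_normal_right.mp h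
  exact hU hu (by simpa using hl)

/-- Every closed normal subgroup is an intersection of open normal subgroups. -/
def OpenNormalSeparated (G : Type*) [Group G] [TopologicalSpace G] : Prop :=
  ∀ L : Subgroup G, L.Normal → IsClosed (L : Set G) → ∀ x, x ∉ L →
    ∃ V : Subgroup G, V.Normal ∧ IsOpen (V : Set G) ∧ L ≤ V ∧ x ∉ V

/-- Separate in `S` from the preimage of `L`: the open subgroup found contains `N`, so its image
still misses `x`. -/
theorem OpenNormalSeparated.quotient {S : Type*} [Group S] [TopologicalSpace S]
    [IsTopologicalGroup S] [CompactSpace S] [TotallyDisconnectedSpace S] (N : Subgroup S)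
    [N.Normal] : OpenNormalSeparated (S ⧸ N) := by
  intro L hL hLc x hx
  obtain ⟨y, rfl⟩ := QuotientGroup.mk'_surjective N x
  have hL' : (L.comap (QuotientGroup.mk' N)).Normal := hL.comap _
  obtain ⟨V, hV, hVo, hLV, hyV⟩ := exists_openNormal_of_notMem_closed
    (L := L.comap (QuotientGroup.mk' N)) (hLc.preimage QuotientGroup.continuous_mk)
    (x := y) hx
  have hNV : N ≤ V := fun n hn => hLV (by
    rw [Subgroup.mem_comap, QuotientGroup.mk'_apply, (QuotientGroup.eq_one_iff n).mpr hn]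
    exact one_mem L)
  refine ⟨V.map (QuotientGroup.mk' N), hV.map _ (QuotientGroup.mk'_surjective N), ?_, ?_, ?_⟩
  · exact QuotientGroup.isOpenMap_coe _ hVo
  · intro l hl
    obtain ⟨k, rfl⟩ := QuotientGroup.mk'_surjective N l
    exact ⟨k, hLV hl, rfl⟩
  · rintro ⟨v, hv, hvy⟩
    have : v⁻¹ * y ∈ N := QuotientGroup.eq.mp hvy
    exact hyV (by simpa using mul_mem hv (hNV this))

theorem exists_addMonoidHom_zmod_ne_zero {p : ℕ} [Fact p.Prime] {A : Type*} [AddCommGroup A]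
    (hA : ∀ a : A, p • a = 0) {x : A} (hx : x ≠ 0) : ∃ χ : A →+ ZMod p, χ x ≠ 0 := by
  let _ : Module (ZMod p) A := AddCommGroup.zmodModule hA
  obtain ⟨φ, hφ⟩ := Module.exists_dual_forall_apply_eq_one (K := ZMod p) (v := id) (s := {x})
    (by simpa using hx)
  exact ⟨φ.toAddMonoidHom, by simpa using (hφ x rfl).trans_ne one_ne_zero⟩

/-- A central subgroup `H` of exponent `p` has characters, and each of them extends to a function
that is equivariant under translation by `H`. -/
theorem exists_equivariant_of_central {p : ℕ} [Fact p.Prime] {Q : Type*} [Group Q]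
    (H : Subgroup Q) (hc : ∀ h ∈ H, ∀ q : Q, q * h = h * q) (hH : ∀ h ∈ H, h ^ p = 1)
    {x : Q} (hx : x ∈ H) (hx1 : x ≠ 1) :
    ∃ c : Q → ZMod p, c x ≠ 0 ∧ ∀ q, ∀ h ∈ H, c (q * h) = c q + c h := by
  let _ : CommGroup H := { (inferInstance : Group H) with
    mul_comm := fun a b => Subtype.ext (hc b b.2 a) }
  obtain ⟨χ, hχ⟩ := exists_addMonoidHom_zmod_ne_zero (p := p) (A := Additive H)
    (x := Additive.ofMul ⟨x, hx⟩)
    (fun a => congrArg Additive.ofMul (Subtype.ext (hH a.toMul a.toMul.2) : a.toMul ^ p = 1))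
    (fun h => hx1 (congrArg Subtype.val (Additive.ofMul.injective h)))
  -- `t q` is the `H`-component of `q` relative to chosen coset representatives.
  let t : Q → H := fun q => ⟨(QuotientGroup.mk q : Q ⧸ H).out⁻¹ * q,
    QuotientGroup.eq.mp (Quotient.out_eq _)⟩
  have ht (q : Q) (h : H) : t (q * h) = t q * h := by
    have : (QuotientGroup.mk (q * h) : Q ⧸ H) = QuotientGroup.mk q :=
      QuotientGroup.mk_mul_of_mem _ h.2
    ext
    simp only [t, this, Subgroup.coe_mul, mul_assoc]
  let f : Q → ZMod p := fun q => χ (Additive.ofMul (t q))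
  have hf (q : Q) (h : H) : f (q * h) = f q + χ (Additive.ofMul h) := by
    simp only [f, ht, ofMul_mul, map_add]
  have hf1 (h : H) : f h = f 1 + χ (Additive.ofMul h) := by rw [← hf 1 h, one_mul]
  -- The representative of the trivial coset need not be `1`, hence the normalisation by `f 1`.
  refine ⟨fun q => f q - f 1, ?_, fun q h hh => ?_⟩
  · have := hf1 ⟨x, hx⟩
    simp only at this
    simpa [this] using hχ
  · have h1 := hf q ⟨h, hh⟩
    have h2 := hf1 ⟨h, hh⟩
    simp only at h1 h2
    change f (q * h) - f 1 = f q - f 1 + (f h - f 1)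
    rw [h1, h2]
    ring

/-- Modulo an open normal `V ≥ L` that misses `x`, the image of `H` is central of exponent `p`, and
continuity is automatic. It serves for `(H, L) = (G, G^(2,p))` and `(G^(2,p), G^(3,p))`. -/
theorem OpenNormalSeparated.exists_equivariant {p : ℕ} [Fact p.Prime] {G : Type*} [Group G]
    [TopologicalSpace G] [IsTopologicalGroup G] (hG : OpenNormalSeparated G)
    (H L : Subgroup G) [hL : L.Normal] (hLc : IsClosed (L : Set G))
    (hpow : ∀ h ∈ H, h ^ p ∈ L) (hcomm : ∀ g : G, ∀ h ∈ H, g * h * g⁻¹ * h⁻¹ ∈ L)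
    {x : G} (hx : x ∈ H) (hxL : x ∉ L) :
    ∃ c : C(G, ZMod p), c x ≠ 0 ∧ (∀ g, ∀ h ∈ H, c (g * h) = c g + c h) ∧
      ∀ g, ∀ h ∈ H, c (h * g) = c g + c h := by
  obtain ⟨V, hV, hVo, hLV, hxV⟩ := hG L hL hLc x hxL
  let π := QuotientGroup.mk' V
  have hπ (g : G) (hg : g ∈ V) : π g = 1 := (QuotientGroup.eq_one_iff g).mpr hg
  have hcen (h : G) (hh : h ∈ H) (g : G) : π g * π h = π h * π g := by
    rw [← mul_inv_eq_iff_eq_mul, ← mul_inv_eq_one, ← map_mul, ← map_inv, ← map_mul, ← map_inv, ← map_mul]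
    exact hπ _ (hLV (hcomm g h hh))
  obtain ⟨c, hcx, hc⟩ := exists_equivariant_of_central (p := p) (H.map π)
    (by
      rintro _ ⟨h, hh, rfl⟩ q
      obtain ⟨g, rfl⟩ := QuotientGroup.mk'_surjective V q
      exact hcen h hh g)
    (by
      rintro _ ⟨h, hh, rfl⟩
      rw [← map_pow]
      exact hπ _ (hLV (hpow h hh)))
    (x := π x) ⟨x, hx, rfl⟩ (fun h => hxV ((QuotientGroup.eq_one_iff x).mp h))
  have hdisc : DiscreteTopology (G ⧸ V) := QuotientGroup.discreteTopology hVo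
  refine ⟨⟨fun g => c (π g), continuous_of_discreteTopology.comp QuotientGroup.continuous_mk⟩,
    hcx, fun g h hh => ?_, fun g h hh => ?_⟩
  · simp only [ContinuousMap.coe_mk, map_mul]
    exact hc _ _ ⟨h, hh, rfl⟩
  · simp only [ContinuousMap.coe_mk, map_mul, ← hcen h hh g]
    exact hc _ _ ⟨h, hh, rfl⟩

end Separation

/-! ### Linear algebra of `ℤ/p`-valued characters -/

section Characters

/-- A homomorphism to a group of prime order that vanishes on the common kernel of finitely many
others is a combination of them. -/
theorem mem_closure_image_of_forall_eq_zero {p : ℕ} [Fact p.Prime] {A ι : Type*} [AddGroup A]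
    (β : ι → A →+ ZMod p) (t : Finset ι) (χ : A →+ ZMod p)
    (h : ∀ x, (∀ i ∈ t, β i x = 0) → χ x = 0) : χ ∈ AddSubgroup.closure (β '' t) := by
  classical
  induction t using Finset.induction_on generalizing χ with
  | empty =>
    have : χ = 0 := by ext x; simpa using h x (by simp)
    simp [this]
  | insert i t hi ih =>
    have hle : AddSubgroup.closure (β '' (t : Set ι)) ≤
        AddSubgroup.closure (β '' ((insert i t : Finset ι) : Set ι)) :=
      AddSubgroup.closure_mono (Set.image_mono (by simp))
    by_cases hy : ∃ y, (∀ j ∈ t, β j y = 0) ∧ β i y ≠ 0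
    · obtain ⟨y, hyt, hyi⟩ := hy
      obtain ⟨n, hn⟩ := ZMod.natCast_zmod_surjective (χ y / β i y)
      have key : χ - n • β i ∈ AddSubgroup.closure (β '' (t : Set ι)) := by
        refine ih _ fun x hx => ?_
        obtain ⟨m, hm⟩ := ZMod.natCast_zmod_surjective (β i x / β i y)
        have hm' : β i x = m * β i y := by rw [hm]; field_simp
        have hn' : χ y = n * β i y := by rw [hn]; field_simp
        have hz : χ (x - m • y) = 0 := by
          refine h _ fun j hj => ?_
          rw [map_sub, map_nsmul, nsmul_eq_mul]
          rcases Finset.mem_insert.mp hj with rfl | hj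
          · rw [hm', sub_self]
          · rw [hx j hj, hyt j hj, mul_zero, sub_zero]
        rw [map_sub, map_nsmul, nsmul_eq_mul, sub_eq_zero] at hz
        simp only [AddMonoidHom.sub_apply, AddMonoidHom.nsmul_apply, nsmul_eq_mul]
        rw [hz, hm', hn']
        ring
      have hi' : β i ∈ AddSubgroup.closure (β '' ((insert i t : Finset ι) : Set ι)) :=
        AddSubgroup.subset_closure ⟨i, by simp, rfl⟩
      simpa using add_mem (hle key) (nsmul_mem hi' n)
    · push Not at hy
      refine hle (ih χ fun x hx => h x fun j hj => ?_)
      rcases Finset.mem_insert.mp hj with rfl | hj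
      · exact hy x hx
      · exact hx j hj

end Characters

/-! ### Transgression through primitives of inflated cocycles -/

section Transgression

variable {p : ℕ} {G : Type*} [Group G] [TopologicalSpace G] {H : Subgroup G} [H.Normal]

/-- `c` is a primitive on `G` of the inflation of the cocycle `f` on `G ⧸ H`. -/
def IsPrimitive (c : C(G, ZMod p)) (f : Z2 p (G ⧸ H)) : Prop :=
  ∀ g k : G, c k - c (g * k) + c g = f.1 (QuotientGroup.mk g, QuotientGroup.mk k)

namespace IsPrimitive

variable {c c' : C(G, ZMod p)} {f f' : Z2 p (G ⧸ H)}

/-- The pairs `(g, h)` and `(g, 1)` have the same image in `G ⧸ H`. The term `c 1` remains because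
`f` is not normalised. -/
theorem apply_mul (hc : IsPrimitive c f) (g : G) {h : G} (hh : h ∈ H) :
    c (g * h) = c g + (c h - c 1) := by
  have h1 := hc g h
  have h2 := hc g 1
  rw [(QuotientGroup.eq_one_iff h).mpr hh] at h1
  rw [QuotientGroup.mk_one, mul_one] at h2
  linear_combination h2 - h1

theorem apply_mul' (hc : IsPrimitive c f) (g : G) {h : G} (hh : h ∈ H) :
    c (h * g) = c g + (c h - c 1) := by
  have h1 := hc h g
  have h2 := hc 1 g
  rw [(QuotientGroup.eq_one_iff h).mpr hh] at h1
  rw [QuotientGroup.mk_one, one_mul] at h2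
  linear_combination h2 - h1

/-- The character of `H` that a primitive of an inflated cocycle restricts to. -/
def char (hc : IsPrimitive c f) : Additive H →+ ZMod p :=
  AddMonoidHom.mk' (fun h => c (h.toMul : G) - c 1) (by
    intro a b
    have := hc.apply_mul a.toMul b.toMul.2
    simp only [toMul_add, Subgroup.coe_mul, this]
    ring)

theorem char_apply (hc : IsPrimitive c f) (h : H) :
    hc.char (Additive.ofMul h) = c h - c 1 := rfl

theorem add (hc : IsPrimitive c f) (hc' : IsPrimitive c' f') : IsPrimitive (c + c') (f + f') := by
  intro g k
  have h1 := hc g k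
  have h2 := hc' g k
  simp only [ContinuousMap.add_apply, AddSubgroup.coe_add]
  linear_combination h1 + h2

theorem neg (hc : IsPrimitive c f) : IsPrimitive (-c) (-f) := by
  intro g k
  have h1 := hc g k
  simp only [ContinuousMap.neg_apply, AddSubgroup.coe_neg]
  linear_combination -h1

theorem zero : IsPrimitive (0 : C(G, ZMod p)) (0 : Z2 p (G ⧸ H)) := by
  intro g k
  simp

end IsPrimitive

theorem H1.exists_descent (φ : H1 p G) (hφ : ∀ h ∈ H, φ.val h = 0) :
    ∃ ψ : H1 p (G ⧸ H), ∀ g, ψ.val (QuotientGroup.mk g) = φ.val g := by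
  let ψ : G ⧸ H →* Multiplicative (ZMod p) := QuotientGroup.lift H (φ : G →* _) fun h hh =>
    Multiplicative.toAdd.injective (hφ h hh)
  refine ⟨⟨ψ, ?_⟩, fun g => rfl⟩
  exact (QuotientGroup.isQuotientMap_mk (N := H)).continuous_iff.mpr φ.continuous_toFun

variable [IsTopologicalGroup G]

theorem TrivialCoeffCohomology.H2.mk_eq_zero_iff {f : Z2 p G} :
    H2.mk f = 0 ↔ ∃ b : C(G, ZMod p), ∀ g k, b k - b (g * k) + b g = f.1 (g, k) := by
  rw [H2.mk, QuotientAddGroup.eq_zero_iff, AddSubgroup.mem_addSubgroupOf]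
  constructor
  · rintro ⟨b, hb⟩
    exact ⟨b, fun g k => congrArg (fun F : C(G × G, ZMod p) => F (g, k)) hb⟩
  · rintro ⟨b, hb⟩
    exact ⟨b, by ext ⟨g, k⟩; exact hb g k⟩

theorem mem_ker_inflation_iff {f : Z2 p (G ⧸ H)} :
    H2.mk f ∈ (inflation (p := p) H).ker ↔ ∃ c : C(G, ZMod p), IsPrimitive c f := by
  have : inflation (p := p) H (H2.mk f) =
      H2.mk (Z2.pullback ⟨QuotientGroup.mk' H, QuotientGroup.continuous_mk⟩ f) := rfl
  rw [AddMonoidHom.mem_ker, this, H2.mk_eq_zero_iff]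
  rfl

/-- The class `α` is, up to sign, the transgression of the character `χ` of `H`. -/
def Transgresses (χ : Additive H →+ ZMod p) (α : H2 p (G ⧸ H)) : Prop :=
  ∃ (f : Z2 p (G ⧸ H)) (c : C(G, ZMod p)) (hc : IsPrimitive c f), H2.mk f = α ∧ hc.char = χ

theorem exists_transgresses {α : H2 p (G ⧸ H)} (hα : α ∈ (inflation (p := p) H).ker) :
    ∃ χ : Additive H →+ ZMod p, Transgresses χ α := by
  obtain ⟨f, rfl⟩ := QuotientAddGroup.mk_surjective α
  obtain ⟨c, hc⟩ := mem_ker_inflation_iff.mp hα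
  exact ⟨hc.char, f, c, hc, rfl, rfl⟩

namespace Transgresses

variable {χ χ' : Additive H →+ ZMod p} {α α' : H2 p (G ⧸ H)}

theorem zero : Transgresses (0 : Additive H →+ ZMod p) (0 : H2 p (G ⧸ H)) :=
  ⟨0, 0, .zero, rfl, by ext h; simp [IsPrimitive.char]⟩

theorem add (h : Transgresses χ α) (h' : Transgresses χ' α') :
    Transgresses (χ + χ') (α + α') := by
  obtain ⟨f, c, hc, rfl, rfl⟩ := h
  obtain ⟨f', c', hc', rfl, rfl⟩ := h'
  refine ⟨f + f', c + c', hc.add hc', rfl, ?_⟩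
  ext h
  simp [IsPrimitive.char]
  ring

theorem neg (h : Transgresses χ α) : Transgresses (-χ) (-α) := by
  obtain ⟨f, c, hc, rfl, rfl⟩ := h
  refine ⟨-f, -c, hc.neg, rfl, ?_⟩
  ext h
  simp [IsPrimitive.char]
  ring

/-- If all of `H¹(G)` comes from `G ⧸ H`, then the transgression is single valued
(in the inverse direction). -/
theorem eq_zero_of_class_eq_zero (hH : ∀ φ : H1 p G, ∀ h ∈ H, φ.val h = 0)
    (h : Transgresses χ 0) : χ = 0 := by
  obtain ⟨f, c, hc, hf, rfl⟩ := h
  obtain ⟨b, hb⟩ := H2.mk_eq_zero_iff.mp hf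
  -- On `G`, both `c` and the inflation of `b` are primitives of `f`, so their difference is a
  -- homomorphism.
  let φ : H1 p G :=
    { toMonoidHom := MonoidHom.mk' (fun g => Multiplicative.ofAdd (c g - b (QuotientGroup.mk g))) (by
        intro g k
        rw [← ofAdd_add]
        congr 1
        have h1 := hc g k
        have h2 := hb (QuotientGroup.mk g) (QuotientGroup.mk k)
        rw [QuotientGroup.mk_mul]
        linear_combination h2 - h1)
      continuous_toFun := continuous_ofAdd.comp
        (c.continuous.sub (b.continuous.comp QuotientGroup.continuous_mk)) }
  have hφ (g : G) : φ.val g = c g - b (QuotientGroup.mk g) := rfl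
  refine AddMonoidHom.ext fun h => ?_
  have h1 := hH φ h.toMul h.toMul.2
  have h2 := hH φ 1 (one_mem H)
  rw [hφ, (QuotientGroup.eq_one_iff _).mpr h.toMul.2] at h1
  rw [hφ, QuotientGroup.mk_one] at h2
  simp only [IsPrimitive.char, AddMonoidHom.mk'_apply, AddMonoidHom.zero_apply]
  linear_combination h1 - h2

theorem character_unique (hH : ∀ φ : H1 p G, ∀ h ∈ H, φ.val h = 0)
    (h : Transgresses χ α) (h' : Transgresses χ' α) : χ = χ' := by
  have := (h.add h'.neg)
  rw [add_neg_cancel] at this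
  exact add_neg_eq_zero.mp (this.eq_zero_of_class_eq_zero hH)

/-- A primitive with trivial character is constant on cosets of `H`, so it descends and bounds `f`
already on `G ⧸ H`. -/
theorem eq_zero_of_character_eq_zero (h : Transgresses 0 α) : α = 0 := by
  obtain ⟨f, c, hc, rfl, h0⟩ := h
  have hout (g : G) : c (QuotientGroup.mk g : G ⧸ H).out = c g := by
    have hm : g⁻¹ * (QuotientGroup.mk g : G ⧸ H).out ∈ H :=
      QuotientGroup.eq.mp (Quotient.out_eq _).symm
    have h1 := hc.apply_mul g hm
    have h2 := (hc.char_apply ⟨_, hm⟩).symm.trans (DFunLike.congr_fun h0 _)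
    rw [mul_inv_cancel_left] at h1
    rw [h1, h2, AddMonoidHom.zero_apply, add_zero]
  refine H2.mk_eq_zero_iff.mpr ⟨⟨fun x => c x.out, ?_⟩, ?_⟩
  · rw [(QuotientGroup.isQuotientMap_mk (N := H)).continuous_iff]
    exact c.continuous.congr fun g => (hout g).symm
  · intro x y
    induction x using QuotientGroup.induction_on with | H g => ?_
    induction y using QuotientGroup.induction_on with | H k => ?_
    rw [← hc g k]
    simp only [ContinuousMap.coe_mk, ← QuotientGroup.mk_mul, hout]

theorem class_unique (h : Transgresses χ α) (h' : Transgresses χ α') : α = α' := by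
  have := h.add h'.neg
  rw [add_neg_cancel] at this
  exact add_neg_eq_zero.mp this.eq_zero_of_character_eq_zero

end Transgresses

/-- An equivariant function is a primitive of an inflated cocycle. -/
theorem exists_isPrimitive_of_equivariant (c : C(G, ZMod p))
    (h₁ : ∀ g, ∀ h ∈ H, c (g * h) = c g + c h) (h₂ : ∀ g, ∀ h ∈ H, c (h * g) = c g + c h) :
    ∃ f : Z2 p (G ⧸ H), IsPrimitive c f := by
  let F : G × G → ZMod p := fun x => c x.2 - c (x.1 * x.2) + c x.1
  -- The coboundary of `c` depends only on cosets, since two-sided equivariance makes `c` invariant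
  -- on `H` under conjugation (`h3`).
  have hF (g k h l : G) (hh : h ∈ H) (hl : l ∈ H) : F (g * h, k * l) = F (g, k) := by
    have e : g * h * (k * l) = (g * k) * ((k⁻¹ * h * k) * l) := by group
    have hconj : k⁻¹ * h * k ∈ H := by
      simpa using (inferInstance : H.Normal).conj_mem h hh k⁻¹
    have h3 : c (k⁻¹ * h * k) = c h := by
      have e1 := h₁ k _ hconj
      have e2 := h₂ k h hh
      rw [show k * (k⁻¹ * h * k) = h * k by group, e2] at e1
      exact (add_left_cancel e1).symm
    simp only [F]
    rw [e, h₁ _ _ (mul_mem hconj hl), h₁ _ _ hl, h₁ _ _ hl, h₁ _ _ hh, h3]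
    ring
  let F' : (G ⧸ H) × (G ⧸ H) → ZMod p := fun x => F (x.1.out, x.2.out)
  have hF' (g k : G) : F' (QuotientGroup.mk g, QuotientGroup.mk k) = F (g, k) := by
    have hm (g : G) : g⁻¹ * (QuotientGroup.mk g : G ⧸ H).out ∈ H :=
      QuotientGroup.eq.mp (Quotient.out_eq _).symm
    have := hF g k _ _ (hm g) (hm k)
    rwa [mul_inv_cancel_left, mul_inv_cancel_left] at this
  have hFc : Continuous F := by fun_prop
  have hcont : Continuous F' := by
    have hq : IsOpenQuotientMap (Prod.map (QuotientGroup.mk : G → G ⧸ H)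
        (QuotientGroup.mk : G → G ⧸ H)) :=
      QuotientGroup.isOpenQuotientMap_mk.prodMap QuotientGroup.isOpenQuotientMap_mk
    rw [hq.isQuotientMap.continuous_iff]
    exact hFc.congr fun x => (hF' x.1 x.2).symm
  refine ⟨⟨⟨F', hcont⟩, ?_⟩, fun g k => (hF' g k).symm⟩
  intro x y z
  induction x using QuotientGroup.induction_on with | H g => ?_
  induction y using QuotientGroup.induction_on with | H h => ?_
  induction z using QuotientGroup.induction_on with | H k => ?_
  simp only [ContinuousMap.coe_mk, ← QuotientGroup.mk_mul, hF', F, mul_assoc]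
  ring

end Transgression

/-! ### The lower `p`-central filtration and characters -/

section LowerCentralSeries

variable {p : ℕ} {G : Type*} [Group G] [TopologicalSpace G] [IsTopologicalGroup G]

theorem isClosed_lowerPCentral (n : ℕ) : IsClosed (lowerPCentral G p n : Set G) := by
  match n with
  | 0 => exact isClosed_univ
  | 1 => exact isClosed_univ
  | n + 2 => exact Subgroup.isClosed_topologicalClosure _

theorem pow_mem_lowerPCentral {n : ℕ} {x : G} (hx : x ∈ lowerPCentral G p (n + 1)) :
    x ^ p ∈ lowerPCentral G p (n + 2) :=
  Subgroup.le_topologicalClosure _ (Subgroup.mem_sup_left (Subgroup.subset_closure ⟨x, hx, rfl⟩))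

theorem commutator_mem_lowerPCentral {n : ℕ} (g : G) {x : G}
    (hx : x ∈ lowerPCentral G p (n + 1)) : g * x * g⁻¹ * x⁻¹ ∈ lowerPCentral G p (n + 2) :=
  Subgroup.le_topologicalClosure _
    (Subgroup.mem_sup_right (Subgroup.commutator_mem_commutator (Subgroup.mem_top g) hx))

theorem lowerPCentral_succ_le {n : ℕ} {K : Subgroup G} (hK : IsClosed (K : Set G))
    (hpow : ∀ x ∈ lowerPCentral G p (n + 1), x ^ p ∈ K)
    (hcomm : ∀ g, ∀ x ∈ lowerPCentral G p (n + 1), g * x * g⁻¹ * x⁻¹ ∈ K) :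
    lowerPCentral G p (n + 2) ≤ K := by
  refine Subgroup.topologicalClosure_minimal _ (sup_le ?_ ?_) hK
  · rw [Subgroup.closure_le]
    rintro _ ⟨x, hx, rfl⟩
    exact hpow x hx
  · exact Subgroup.commutator_le.mpr fun g _ x hx => hcomm g x hx

theorem H1_val_eq_zero_of_mem_lowerPCentral (φ : H1 p G) {x : G} (hx : x ∈ lowerPCentral G p 2) :
    φ.val x = 0 := by
  have hK : IsClosed (((φ : G →* Multiplicative (ZMod p)).ker : Subgroup G) : Set G) :=
    (isClosed_discrete ({1} : Set (Multiplicative (ZMod p)))).preimage φ.continuous_toFun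
  refine congrArg Multiplicative.toAdd
    (lowerPCentral_succ_le (n := 0) hK (fun y _ => ?_) (fun g y _ => ?_) hx)
  · rw [MonoidHom.mem_ker, map_pow]
    exact Multiplicative.toAdd.injective (by simp)
  · rw [MonoidHom.mem_ker, map_mul, map_mul, map_mul, map_inv, map_inv,
      mul_comm (_ : Multiplicative (ZMod p)), mul_comm (_ * _)]
    simp

/-- The kernel of `χ` is closed and contains `p`-th powers because `ℤ/p` has exponent `p`. It
contains commutators because left and right equivariance, compared on `g y = (g y g⁻¹) g`, make `χ`
invariant under conjugation. -/
theorem Transgresses.apply_eq_zero_of_mem {χ : Additive (lowerPCentral G p 2) →+ ZMod p}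
    {α : H2 p (G ⧸ lowerPCentral G p 2)} (h : Transgresses χ α) {x : G}
    (hx₂ : x ∈ lowerPCentral G p 2) (hx : x ∈ lowerPCentral G p 3) :
    χ (Additive.ofMul ⟨x, hx₂⟩) = 0 := by
  obtain ⟨f, c, hc, -, rfl⟩ := h
  let K : Subgroup G := (AddMonoidHom.toMultiplicativeRight hc.char).ker.map
    (lowerPCentral G p 2).subtype
  have hmem (y : G) (hy : y ∈ lowerPCentral G p 2) : y ∈ K ↔ c y = c 1 := by
    constructor
    · rintro ⟨k, hk, rfl⟩
      exact sub_eq_zero.mp (congrArg Multiplicative.toAdd hk)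
    · intro h
      exact ⟨⟨y, hy⟩, congrArg Multiplicative.ofAdd (sub_eq_zero.mpr h), rfl⟩
  have hK : (K : Set G) = (lowerPCentral G p 2 : Set G) ∩ {y | c y = c 1} := by
    ext y
    constructor
    · intro hy
      have hy2 : y ∈ lowerPCentral G p 2 := by
        obtain ⟨k, -, rfl⟩ := hy
        exact k.2
      exact ⟨hy2, (hmem y hy2).mp hy⟩
    · rintro ⟨hy2, hy⟩
      exact (hmem y hy2).mpr hy
  refine sub_eq_zero.mpr ((hmem x hx₂).mp (lowerPCentral_succ_le (n := 1) ?_ ?_ ?_ hx))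
  · rw [hK]
    exact (isClosed_lowerPCentral 2).inter (isClosed_eq c.continuous continuous_const)
  · intro y hy
    refine ⟨⟨y, hy⟩ ^ p, ?_, rfl⟩
    refine congrArg Multiplicative.ofAdd (?_ : hc.char (Additive.ofMul (⟨y, hy⟩ ^ p)) = 0)
    rw [ofMul_pow, map_nsmul]
    simp
  · intro g y hy
    have hm : g * y * g⁻¹ ∈ lowerPCentral G p 2 :=
      (inferInstance : (lowerPCentral G p 2).Normal).conj_mem y hy g
    have h1 := hc.apply_mul g hy
    have h2 := hc.apply_mul' g hm
    rw [inv_mul_cancel_right, h1] at h2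
    have h3 : hc.char (Additive.ofMul ⟨_, hm⟩) = hc.char (Additive.ofMul ⟨y, hy⟩) :=
      (add_left_cancel h2).symm
    refine ⟨⟨_, hm⟩ * ⟨y, hy⟩⁻¹, ?_, rfl⟩
    refine congrArg Multiplicative.ofAdd
      (?_ : hc.char (Additive.ofMul (⟨_, hm⟩ * ⟨y, hy⟩⁻¹)) = 0)
    rw [ofMul_mul, ofMul_inv, map_add, map_neg, h3, add_neg_cancel]

end LowerCentralSeries

/-! ### Homomorphisms to `M_{p³}`, Bockstein and cup classes, and duality -/

section BocksteinCup

variable {p : ℕ} [Fact p.Prime] {G : Type*} [Group G] [TopologicalSpace G]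

/-- `ℤ/p²` embeds in `M_{p³}` as the cyclic group generated by `r`. -/
theorem kernelIntersection_extraSpecial_le_zmod_sq :
    kernelIntersection G (ExtraSpecialGroup p) ≤
      kernelIntersection G (Multiplicative (ZMod (p ^ 2))) := by
  have hp : 0 < p := (Fact.out : p.Prime).pos
  have hp2 : NeZero (p ^ 2) := ⟨(pow_pos hp 2).ne'⟩
  have hg : (BocksteinCupExtension.gen₀ : BocksteinCupExtension p) ^ p ^ 2 = 1 := by
    rw [BocksteinCupExtension.gen₀_pow, pow_two, Nat.mul_div_cancel _ hp]
    ext <;> simp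
  let ι : Multiplicative (ZMod (p ^ 2)) →* BocksteinCupExtension p :=
    MonoidHom.mk' (fun a => BocksteinCupExtension.gen₀ ^ a.toAdd.val) fun a b => by
      rw [← pow_add]
      exact pow_eq_pow_of_natCast_eq hg (by simp)
  have hι (a) (ha : ι a = 1) : a = 1 := by
    have h : (⟨(a.toAdd.val : ℕ), 0, (a.toAdd.val / p : ℕ)⟩ : BocksteinCupExtension p) = 1 := by
      rw [← BocksteinCupExtension.gen₀_pow]
      exact ha
    have h1 := (ZMod.natCast_eq_zero_iff _ _).mp (congrArg BocksteinCupExtension.fst h)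
    have h2 := (ZMod.natCast_eq_zero_iff _ _).mp (congrArg BocksteinCupExtension.central h)
    have h3 : p ^ 2 ∣ a.toAdd.val := by
      have := Nat.mul_dvd_mul_right h2 p
      rwa [Nat.div_mul_cancel h1, ← pow_two] at this
    exact Multiplicative.toAdd.injective ((ZMod.val_eq_zero _).mp
      (Nat.eq_zero_of_dvd_of_lt h3 (ZMod.val_lt _)))
  intro x hx
  rw [kernelIntersection, Subgroup.mem_iInf] at hx ⊢
  intro ρ
  have := hx ⟨(BocksteinCupExtension.toExtraSpecialGroup.comp ι).comp (ρ : G →* _),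
    (continuous_of_discreteTopology
      (f := fun a => BocksteinCupExtension.toExtraSpecialGroup (ι a))).comp ρ.continuous_toFun⟩
  refine hι _ ((BocksteinCupExtension.extraSpecialGroupEquiv p).symm.injective ?_)
  rw [map_one]
  exact this

variable [IsTopologicalGroup G]

/-- Characters of `G` separate points from `G^(2,p)`, and `ℤ/p` embeds in `M_{p³}` through `s`. -/
theorem kernelIntersection_extraSpecial_le_lowerPCentral_two (hG : OpenNormalSeparated G) :
    kernelIntersection G (ExtraSpecialGroup p) ≤ lowerPCentral G p 2 := by
  intro x hx
  by_contra hxn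
  obtain ⟨c, hcx, hc, -⟩ := hG.exists_equivariant (p := p) ⊤ (lowerPCentral G p 2)
    (isClosed_lowerPCentral 2) (fun h hh => pow_mem_lowerPCentral (n := 0) hh)
    (fun g h hh => commutator_mem_lowerPCentral (n := 0) g hh) (Subgroup.mem_top x) hxn
  let ρ : G →* BocksteinCupExtension p := MonoidHom.mk' (fun g => ⟨0, c g, 0⟩) fun g k => by
    ext <;> simp [carry_zero_left, hc g k]
  rw [kernelIntersection, Subgroup.mem_iInf] at hx
  have := hx ⟨BocksteinCupExtension.toExtraSpecialGroup.comp ρ,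
    (continuous_of_discreteTopology (f := fun a : ZMod p =>
      BocksteinCupExtension.toExtraSpecialGroup ⟨0, a, 0⟩)).comp c.continuous⟩
  have h : ρ x = 1 := (BocksteinCupExtension.extraSpecialGroupEquiv p).symm.injective (by
    rw [map_one]
    exact this)
  exact hcx (congrArg BocksteinCupExtension.snd h)

variable (p G) in
/-- The elements of the kernel of inflation from `G / G^(2,p)` that have the form
`Bock(ρ)` or `Bock(ρ) + ρ ∪ ρ'`. -/
def bocksteinCupKernelSet : Set (H2 p (G ⧸ lowerPCentral G p 2)) :=
  {α | α ∈ (inflation (p := p) (lowerPCentral G p 2)).ker ∧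
    ((∃ ρ : H1 p (G ⧸ lowerPCentral G p 2), α = bockstein ρ) ∨
      ∃ ρ ρ' : H1 p (G ⧸ lowerPCentral G p 2), α = bockstein ρ + cup ρ ρ')}

/-- Every class of the form `Bock(ρ)` or `Bock(ρ) + ρ ∪ ρ'` is represented by the pullback along
`(ρ, ρ')` of the cocycle that defines `M_{p³}`. -/
theorem exists_cocycle_of_mem_bocksteinCupKernelSet {α : H2 p (G ⧸ lowerPCentral G p 2)}
    (hα : α ∈ bocksteinCupKernelSet p G) :
    ∃ (ρ ρ' : H1 p (G ⧸ lowerPCentral G p 2)) (f : Z2 p (G ⧸ lowerPCentral G p 2)),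
      H2.mk f = α ∧ ∀ x y, f.1 (x, y) = carry (ρ.val x) (ρ.val y) + ρ.val x * ρ'.val y := by
  rcases hα.2 with ⟨ρ, rfl⟩ | ⟨ρ, ρ', rfl⟩
  · obtain ⟨f, hf⟩ : ∃ f : Z2 p (G ⧸ lowerPCentral G p 2), H2.mk f = bockstein ρ ∧
        ∀ x y, f.1 (x, y) = carry (ρ.val x) (ρ.val y) := ⟨_, rfl, fun _ _ => rfl⟩
    -- `1` is the trivial character, so the cup product term vanishes.
    refine ⟨ρ, 1, f, hf.1, fun x y => ?_⟩
    have : H1.val (1 : H1 p (G ⧸ lowerPCentral G p 2)) y = 0 := rfl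
    rw [this, mul_zero, add_zero, hf.2]
  · obtain ⟨f, hf⟩ : ∃ f : Z2 p (G ⧸ lowerPCentral G p 2), H2.mk f = bockstein ρ ∧
        ∀ x y, f.1 (x, y) = carry (ρ.val x) (ρ.val y) := ⟨_, rfl, fun _ _ => rfl⟩
    obtain ⟨f', hf'⟩ : ∃ f : Z2 p (G ⧸ lowerPCentral G p 2), H2.mk f = cup ρ ρ' ∧
        ∀ x y, f.1 (x, y) = ρ.val x * ρ'.val y := ⟨_, rfl, fun _ _ => rfl⟩
    refine ⟨ρ, ρ', f + f', ?_, fun x y => ?_⟩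
    · rw [← hf.1, ← hf'.1]
      rfl
    · rw [← hf.2, ← hf'.2]
      rfl

theorem exists_transgresses_of_mem_bocksteinCupKernelSet {α : H2 p (G ⧸ lowerPCentral G p 2)}
    (hα : α ∈ bocksteinCupKernelSet p G) :
    ∃ χ : Additive (lowerPCentral G p 2) →+ ZMod p, Transgresses χ α ∧
      ∀ h : lowerPCentral G p 2, (h : G) ∈ kernelIntersection G (ExtraSpecialGroup p) →
        χ (Additive.ofMul h) = 0 := by
  obtain ⟨ρ, ρ', f, rfl, hf⟩ := exists_cocycle_of_mem_bocksteinCupKernelSet hα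
  obtain ⟨c, hc⟩ := mem_ker_inflation_iff.mp hα.1
  refine ⟨hc.char, ⟨f, c, hc, rfl, rfl⟩, fun h hh => ?_⟩
  -- The sign: `dc = f` reads `c(gk) = c(g) + c(k) - f`, while the central coordinate of a product
  -- gains `+f`.
  let F : ZMod p × ZMod p × ZMod p → BocksteinCupExtension p := fun a => ⟨a.1, a.2.1, -a.2.2⟩
  let φ : G →* BocksteinCupExtension p :=
    MonoidHom.mk' (fun g => F (ρ.val (QuotientGroup.mk g), ρ'.val (QuotientGroup.mk g), c g))
      fun g k => by
        have h1 := hc g k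
        rw [hf] at h1
        ext
        · simp [F, H1.val_mul]
        · simp [F, H1.val_mul]
        · simp only [F, BocksteinCupExtension.mul_central]
          linear_combination h1
  rw [kernelIntersection, Subgroup.mem_iInf] at hh
  have h2 := hh ⟨BocksteinCupExtension.toExtraSpecialGroup.comp φ,
    (continuous_of_discreteTopology (f := BocksteinCupExtension.toExtraSpecialGroup ∘ F)).comp
      ((ρ.continuous_val.comp QuotientGroup.continuous_mk).prodMk
        ((ρ'.continuous_val.comp QuotientGroup.continuous_mk).prodMk c.continuous))⟩
  have h3 : φ h = 1 := (BocksteinCupExtension.extraSpecialGroupEquiv p).symm.injective (by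
    rw [map_one]
    exact h2)
  have h4 : -c h = 0 := congrArg BocksteinCupExtension.central h3
  have h5 : -c 1 = 0 := congrArg BocksteinCupExtension.central (map_one φ)
  rw [hc.char_apply]
  linear_combination h5 - h4

/-- The restriction to `G^(2,p)` of a homomorphism to `M_{p³}` is detected by a character that
transgresses to a class of the form `Bock(ρ) + ρ ∪ ρ'`. -/
theorem exists_transgresses_of_extraSpecial (φ : G →ₜ* ExtraSpecialGroup p) :
    ∃ α ∈ bocksteinCupKernelSet p G, ∃ χ : Additive (lowerPCentral G p 2) →+ ZMod p,
      Transgresses χ α ∧ ∀ h : lowerPCentral G p 2, χ (Additive.ofMul h) = 0 → φ h = 1 := by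
  let e := BocksteinCupExtension.extraSpecialGroupEquiv p
  have hcont (F : ExtraSpecialGroup p → ZMod p) : Continuous fun g => F (φ g) :=
    continuous_of_discreteTopology.comp φ.continuous_toFun
  let a : H1 p G := ⟨MonoidHom.mk' (fun g => Multiplicative.ofAdd (e (φ g)).fst) fun g k => by
    simp, continuous_ofAdd.comp (hcont fun y => (e y).fst)⟩
  let b : H1 p G := ⟨MonoidHom.mk' (fun g => Multiplicative.ofAdd (e (φ g)).snd) fun g k => by
    simp, continuous_ofAdd.comp (hcont fun y => (e y).snd)⟩
  let c : C(G, ZMod p) := ⟨fun g => -(e (φ g)).central, hcont fun y => -(e y).central⟩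
  have ha (g : G) : a.val g = (e (φ g)).fst := rfl
  have hb (g : G) : b.val g = (e (φ g)).snd := rfl
  obtain ⟨ρ, hρ⟩ := H1.exists_descent a fun h hh => H1_val_eq_zero_of_mem_lowerPCentral a hh
  obtain ⟨ρ', hρ'⟩ := H1.exists_descent b fun h hh => H1_val_eq_zero_of_mem_lowerPCentral b hh
  obtain ⟨f, hf, hfv⟩ : ∃ f : Z2 p (G ⧸ lowerPCentral G p 2),
      H2.mk f = bockstein ρ + cup ρ ρ' ∧
        ∀ x y, f.1 (x, y) = carry (ρ.val x) (ρ.val y) + ρ.val x * ρ'.val y :=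
    ⟨_ + _, rfl, fun _ _ => rfl⟩
  have hc : IsPrimitive c f := by
    intro g k
    rw [hfv, hρ, hρ, hρ', ha, ha, hb]
    simp only [c, ContinuousMap.coe_mk, map_mul, BocksteinCupExtension.mul_central]
    ring
  refine ⟨H2.mk f, ⟨mem_ker_inflation_iff.mpr ⟨c, hc⟩, Or.inr ⟨ρ, ρ', hf⟩⟩, hc.char,
    ⟨f, c, hc, rfl, rfl⟩, fun h hh => e.injective ?_⟩
  have h1 : c 1 = 0 := by simp [c]
  rw [hc.char_apply, h1, sub_zero] at hh
  rw [map_one]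
  ext
  · exact H1_val_eq_zero_of_mem_lowerPCentral a h.2
  · exact H1_val_eq_zero_of_mem_lowerPCentral b h.2
  · exact neg_eq_zero.mp hh

theorem mem_kernelIntersection_extraSpecial {x : G} (hx : x ∈ lowerPCentral G p 2)
    (h : ∀ α ∈ bocksteinCupKernelSet p G, ∀ χ : Additive (lowerPCentral G p 2) →+ ZMod p,
      Transgresses χ α → χ (Additive.ofMul ⟨x, hx⟩) = 0) :
    x ∈ kernelIntersection G (ExtraSpecialGroup p) := by
  rw [kernelIntersection, Subgroup.mem_iInf]
  intro φ
  obtain ⟨α, hα, χ, hχ, hφ⟩ := exists_transgresses_of_extraSpecial φ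
  exact hφ ⟨x, hx⟩ (h α hα χ hχ)

/-- The common kernel of the characters `ψ β` lies in `T^M(G) ≤ G^(3,p)`, where `χ` vanishes. By
compactness finitely many `ψ β` suffice, so `χ` is a combination of them, and its class is the same
combination of the `β`. -/
theorem ker_inflation_eq_closure_of_kernelIntersection_le [CompactSpace G]
    (hT : kernelIntersection G (ExtraSpecialGroup p) ≤ lowerPCentral G p 3) :
    (inflation (p := p) (lowerPCentral G p 2)).ker =
      AddSubgroup.closure (bocksteinCupKernelSet p G) := by
  refine le_antisymm (fun α hα => ?_) ((AddSubgroup.closure_le _).mpr fun β hβ => hβ.1)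
  obtain ⟨χ, hχ⟩ := exists_transgresses hα
  have hex (β : bocksteinCupKernelSet p G) := exists_transgresses β.2.1
  choose ψ hψ using hex
  have hclosed {θ : Additive (lowerPCentral G p 2) →+ ZMod p}
      {γ : H2 p (G ⧸ lowerPCentral G p 2)} (h : Transgresses θ γ) :
      IsClopen {x : lowerPCentral G p 2 | θ (Additive.ofMul x) = 0} := by
    obtain ⟨f, c, hc, -, rfl⟩ := h
    exact (isClopen_discrete ({0} : Set (ZMod p))).preimage
      ((c.continuous.comp continuous_subtype_val).sub continuous_const :
        Continuous fun x : lowerPCentral G p 2 => c x - c 1)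
  have : CompactSpace (lowerPCentral G p 2) :=
    isCompact_iff_compactSpace.mp (isClosed_lowerPCentral 2).isCompact
  -- The set where `χ ≠ 0` is compact and misses the intersection of the closed sets `ψ β = 0`.
  obtain ⟨u, hu⟩ := (hclosed hχ).compl.isClosed.isCompact.elim_finite_subfamily_closed
    (fun β => {x | ψ β (Additive.ofMul x) = 0}) (fun β => (hclosed (hψ β)).isClosed) (by
      rw [Set.eq_empty_iff_forall_notMem]
      rintro x ⟨hx, hxψ⟩
      refine hx (hχ.apply_eq_zero_of_mem x.2 (hT
        (mem_kernelIntersection_extraSpecial x.2 fun β hβ θ hθ => ?_)))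
      rw [hθ.character_unique (fun φ h hh => H1_val_eq_zero_of_mem_lowerPCentral φ hh) (hψ ⟨β, hβ⟩)]
      exact Set.mem_iInter.mp hxψ ⟨β, hβ⟩)
  have hmem := mem_closure_image_of_forall_eq_zero ψ u χ fun x hx => by
    by_contra hχx
    exact (Set.eq_empty_iff_forall_notMem.mp hu) x.toMul
      ⟨hχx, Set.mem_iInter₂.mpr fun i hi => hx i hi⟩
  have key : ∀ θ ∈ AddSubgroup.closure (ψ '' u),
      ∃ γ ∈ AddSubgroup.closure (bocksteinCupKernelSet p G), Transgresses θ γ := by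
    intro θ hθ
    induction hθ using AddSubgroup.closure_induction with
    | mem θ hθ =>
      obtain ⟨β, -, rfl⟩ := hθ
      exact ⟨β, AddSubgroup.subset_closure β.2, hψ β⟩
    | zero => exact ⟨0, zero_mem _, .zero⟩
    | add θ θ' _ _ h h' =>
      obtain ⟨γ, hγ, hθγ⟩ := h
      obtain ⟨γ', hγ', hθγ'⟩ := h'
      exact ⟨γ + γ', add_mem hγ hγ', hθγ.add hθγ'⟩
    | neg θ _ h =>
      obtain ⟨γ, hγ, hθγ⟩ := h
      exact ⟨-γ, neg_mem hγ, hθγ.neg⟩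
  obtain ⟨γ, hγ, hχγ⟩ := key χ hmem
  rwa [hχ.class_unique hχγ]

/-- A point of `T^M(G)` is killed by the characters of all generators, hence of the whole kernel of
inflation. Outside `G^(3,p)` some equivariant `c` is nonzero at it, and the coboundary of `c` gives
a class in that kernel: a contradiction. -/
theorem kernelIntersection_eq_of_ker_inflation_eq_closure (hG : OpenNormalSeparated G)
    (hK : (inflation (p := p) (lowerPCentral G p 2)).ker =
      AddSubgroup.closure (bocksteinCupKernelSet p G)) :
    kernelIntersection G (ExtraSpecialGroup p) = lowerPCentral G p 3 := by
  refine le_antisymm (fun x hx => ?_) (fun x hx => ?_)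
  · have hx2 := kernelIntersection_extraSpecial_le_lowerPCentral_two hG hx
    by_contra hxn
    obtain ⟨c, hcx, h₁, h₂⟩ := hG.exists_equivariant (lowerPCentral G p 2) (lowerPCentral G p 3)
      (isClosed_lowerPCentral 3) (fun h hh => pow_mem_lowerPCentral (n := 1) hh)
      (fun g h hh => commutator_mem_lowerPCentral (n := 1) g hh) hx2 hxn
    obtain ⟨f, hc⟩ := exists_isPrimitive_of_equivariant c h₁ h₂
    have hall : ∀ α ∈ AddSubgroup.closure (bocksteinCupKernelSet p G),
        ∃ χ : Additive (lowerPCentral G p 2) →+ ZMod p,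
          Transgresses χ α ∧ χ (Additive.ofMul ⟨x, hx2⟩) = 0 := by
      intro α hα
      induction hα using AddSubgroup.closure_induction with
      | mem α hα =>
        obtain ⟨χ, hχ, h⟩ := exists_transgresses_of_mem_bocksteinCupKernelSet hα
        exact ⟨χ, hχ, h _ hx⟩
      | zero => exact ⟨0, .zero, rfl⟩
      | add α β _ _ h h' =>
        obtain ⟨χ, hχ, h⟩ := h
        obtain ⟨χ', hχ', h'⟩ := h'
        exact ⟨χ + χ', hχ.add hχ', by rw [AddMonoidHom.add_apply, h, h', add_zero]⟩
      | neg α _ h =>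
        obtain ⟨χ, hχ, h⟩ := h
        exact ⟨-χ, hχ.neg, by rw [AddMonoidHom.neg_apply, h, neg_zero]⟩
    obtain ⟨χ, hχ, h⟩ := hall (H2.mk f) (hK ▸ mem_ker_inflation_iff.mpr ⟨c, hc⟩)
    have hχc := hχ.character_unique (fun φ h hh => H1_val_eq_zero_of_mem_lowerPCentral φ hh)
      ⟨f, c, hc, rfl, rfl⟩
    have hc1 : c 1 = 0 := by simpa using h₁ 1 1 (one_mem _)
    rw [hχc, hc.char_apply, hc1, sub_zero] at h
    exact hcx h
  · have hx2 : x ∈ lowerPCentral G p 2 :=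
      lowerPCentral_succ_le (n := 1) (isClosed_lowerPCentral 2)
        (fun y hy => pow_mem hy p)
        (fun g y hy => mul_mem ((inferInstance : (lowerPCentral G p 2).Normal).conj_mem y hy g)
          (inv_mem hy)) hx
    exact mem_kernelIntersection_extraSpecial hx2 fun α _ χ hχ => hχ.apply_eq_zero_of_mem hx2 hx

end BocksteinCup

theorem theorem11p4 (p : ℕ) [Fact p.Prime] (hp : 2 < p)
    (S : Type u) [Group S] [TopologicalSpace S] [IsTopologicalGroup S]
    [CompactSpace S] [TotallyDisconnectedSpace S] (hS : IsFreeProfinite S)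
    (N : Subgroup S) [N.Normal] (hN_closed : IsClosed (N : Set S))
    (hN : N ≤ lowerPCentral S p 2) :
    kernelIntersection (S ⧸ N) (Multiplicative (ZMod (p ^ 2))) ⊓
        kernelIntersection (S ⧸ N) (ExtraSpecialGroup p) = lowerPCentral (S ⧸ N) p 3 ↔
      BocksteinCupKernelCondition p (S ⧸ N) := by
  rw [inf_eq_right.mpr kernelIntersection_extraSpecial_le_zmod_sq]
  exact ⟨fun h => ker_inflation_eq_closure_of_kernelIntersection_le h.le,
    kernelIntersection_eq_of_ker_inflation_eq_closure (OpenNormalSeparated.quotient N)⟩
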